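/- Let $N>1$ and $d\ge 1$ be integers, write $e_M(x)=e^{2\pi i x/M}$, and let $\mathcal H_N=L^2((\mathbb Z/N\mathbb Z)^d)$ with inner product $\langle\psi,\phi\rangle=N^{-d}\sum_{x}\psi(x)\overline{\phi(x)}$. For $n=(n_1,n_2)\in\mathbb Z^d\times\mathbb Z^d=\mathbb Z^{2d}$ let $T_N(n)$ be the operator on $\mathcal H_N$ $$T_N(n)\psi(y)=(-1)^{N\,n_1\cdot n_2}\,e_{2N}(n_1\cdot n_2)\,e_N(n_2\cdot y)\,\psi(y+n_1),$$ which depends only on $n$ modulo $M$, where $M=N$ if $N$ is odd and $M=2N$ if $N$ is even. For $A\in\mathrm{Sp}(2d,\mathbb Z/M\mathbb Z)$, a quantum propagator for $A$ is a unitary operator $U_N(A)$ on $\mathcal H_N$ such that $$U_N(A)^{-1}\,T_N(n)\,U_N(A)=T_N(nA)\qquad\text{for all } n\in\mathbb Z^{2d}$$ ($n$ is regarded as a row vector). Let $G_N=\mathrm{Sp}(2d,\mathbb Z/N\mathbb Z)$ if $N$ is odd, and let $G_N$ be the subgroup of $\mathrm{Sp}(2d,\mathbb Z/2N\mathbb Z)$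 of all matrices congruent to $I$ or to $-I$ modulo $4$ if $N$ is even. **Theorem.** For every $N>1$ the phases of the propagators can be chosen so that $A\mapsto U_N(A)$ is a representation of $G_N$ on $\mathcal H_N$. Precisely: (1) there is a representation $A\mapsto U_N(A)$ of $G_N$ on $\mathcal H_N$ such that $U_N(A)$ is a quantum propagator for $A$, for every $A\in G_N$; and (2) for any choice of a quantum propagator $U_N(A)$ for each $A\in G_N$ there are complex numbers $c(A)$ with $|c(A)|=1$ $(A\in G_N)$ such that $A\mapsto c(A)U_N(A)$ is a representation of $G_N$. -/

import Mathlib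

open Matrix

/-- The space `H_N = L²((ℤ/Nℤ)^d)` of quantum states, of dimension `N ^ d`. -/
abbrev StateSpace (N d : ℕ) : Type := (Fin d → ZMod N) → ℂ

/-- The inner product `⟨ψ, φ⟩ = N^{-d} ∑_x ψ(x) conj(φ(x))` of `H_N`. -/
noncomputable def stateInner {N d : ℕ} [NeZero N] (ψ φ : StateSpace N d) : ℂ :=
  (1 / (N : ℂ) ^ d) * ∑ x : Fin d → ZMod N, ψ x * (starRingEnd ℂ) (φ x)

/-- Unitary operators of `H_N`: linear bijections preserving the inner product. -/
def IsUnitaryOperator {N d : ℕ} [NeZero N] (U : Module.End ℂ (StateSpace N d)) : Prop :=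
  Function.Bijective U ∧ ∀ ψ φ, stateInner (U ψ) (U φ) = stateInner ψ φ

/-- The elementary operator attached to `n = (n₁, n₂) ∈ ℤ^d × ℤ^d`,
`ψ ↦ (y ↦ e_{2N}(n₁ · n₂) e_N(n₂ · y) ψ(y + n₁))`, where `e_M(x) = exp(2πix/M)`
(`ZMod.stdAddChar` on `ZMod M`). -/
noncomputable def elemOp (N : ℕ) [NeZero N] {d : ℕ} (n : Fin d ⊕ Fin d → ℤ) :
    Module.End ℂ (StateSpace N d) where
  toFun ψ y :=
    ZMod.stdAddChar (((n ∘ Sum.inl) ⬝ᵥ (n ∘ Sum.inr) : ℤ) : ZMod (2 * N)) *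
      ZMod.stdAddChar ((fun i => (n (Sum.inr i) : ZMod N)) ⬝ᵥ y) *
      ψ (y + fun i => (n (Sum.inl i) : ZMod N))
  map_add' ψ φ := by
    ext y; simp only [Pi.add_apply]; ring
  map_smul' c ψ := by
    ext y; simp only [Pi.smul_apply, smul_eq_mul, RingHom.id_apply]; ring

/-- The twisted elementary operator `T_N(n) = (-1)^{N n₁ · n₂} · elemOp N n`. -/
noncomputable def twistedOp (N : ℕ) [NeZero N] {d : ℕ} (n : Fin d ⊕ Fin d → ℤ) :
    Module.End ℂ (StateSpace N d) :=
  ((-1 : ℂ) ^ ((N : ℤ) * ((n ∘ Sum.inl) ⬝ᵥ (n ∘ Sum.inr)))) • elemOp N n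

/-- `U` is a quantum propagator for the matrix `A` over `ℤ/Mℤ` (`M = N` for odd `N`, `M = 2N` for
even `N`): it is unitary and `U T_N(nA) = T_N(n) U` for all `n ∈ ℤ^{2d}`, i.e.
`U⁻¹ T_N(n) U = T_N(nA)`. Vectors are rows, and `m` runs over all the integral representatives of
`nA ∈ (ℤ/Mℤ)^{2d}`; the operator `T_N(m)` does not depend on which one is taken. -/
def IsPropagator (N : ℕ) [NeZero N] {d M : ℕ} (A : Matrix (Fin d ⊕ Fin d) (Fin d ⊕ Fin d) (ZMod M))
    (U : Module.End ℂ (StateSpace N d)) : Prop :=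
  IsUnitaryOperator U ∧
    ∀ n m : Fin d ⊕ Fin d → ℤ,
      (fun i => (m i : ZMod M)) = (fun i => (n i : ZMod M)) ᵥ* A →
        U * twistedOp N m = twistedOp N n * U

/-- The subgroup of `Sp(2d, ℤ/Mℤ)` of the matrices congruent to `I` or to `-I` modulo `m`,
for `m ∣ M`. -/
def pmOneSubgroup (d : ℕ) {m M : ℕ} (h : m ∣ M) :
    Subgroup (symplecticGroup (Fin d) (ZMod M)) where
  carrier := {A | (A : Matrix (Fin d ⊕ Fin d) (Fin d ⊕ Fin d) (ZMod M)).map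
      (ZMod.castHom h (ZMod m)) = 1 ∨
    (A : Matrix (Fin d ⊕ Fin d) (Fin d ⊕ Fin d) (ZMod M)).map (ZMod.castHom h (ZMod m)) = -1}
  one_mem' := Or.inl (Matrix.map_one _ (map_zero _) (map_one _))
  mul_mem' {A B} hA hB := by
    simp only [Set.mem_ofPred_eq, Submonoid.coe_mul, Matrix.map_mul] at *
    rcases hA with hA | hA <;> rcases hB with hB | hB <;> simp [hA, hB]
  inv_mem' {A} hA := by
    simp only [Set.mem_ofPred_eq] at *
    have h1 : ((A⁻¹ * A : symplecticGroup (Fin d) (ZMod M)) :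
        Matrix (Fin d ⊕ Fin d) (Fin d ⊕ Fin d) (ZMod M)).map (ZMod.castHom h (ZMod m)) = 1 := by
      rw [inv_mul_cancel]; exact Matrix.map_one _ (map_zero _) (map_one _)
    rw [Submonoid.coe_mul, Matrix.map_mul] at h1
    rcases hA with hA | hA
    · left; simpa [hA] using h1
    · right; rw [hA, mul_neg, mul_one] at h1; rw [← h1, neg_neg]

theorem four_dvd_two_mul_of_even {N : ℕ} (h : Even N) : 4 ∣ 2 * N := by
  obtain ⟨k, rfl⟩ := h
  exact ⟨k, by ring⟩

/-! The operators $T_N(n)$ form a finite Heisenberg system. They act irreducibly, so an intertwiner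
between $n\mapsto T_N(nA)$ and $n\mapsto T_N(n)$ is unique up to a scalar
(`Intertwines.exists_eq_smul`). Averaging over the Weyl operators produces a nonzero one, and
rescaling makes it unitary. The propagators thus form a projective representation:
$U(g)U(k)=c(g,k)\,U(gk)$.

The cocycle is removed by determinants. On an invariant subspace $E$, $\det(U(g)|_E)$ is
multiplicative up to $c(g,k)^{\dim E}$. With two invariant subspaces satisfying $\dim E=\dim F+1$,
the quotient $\det(U|_E)/\det(U|_F)$ is multiplicative up to $c(g,k)$ itself, and dividing $U$ by it
gives a representation (`exists_monoidHom_of_projective`).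

The subspaces $E$ and $F$ are the even and odd parts of a coset space: functions on a group
isomorphic to $(\mathbb Z/m)^d$ with $m$ odd, where negation fixes only $0$, so the even part is
larger by one (`finrank_paritySpace_one`). For odd $N$ the whole space works with $m=N$. For even
$N$ write $N=q\cdot qc\cdot m$ with $c\in\{1,2\}$: the coset space is the fixed space of the Weyl
operators of a lattice, and matrices that are $\pm1$ modulo $4$ preserve it
(`weylOp_vecMul_apply_of_mem_cosetSpace`). -/

set_option linter.unusedSectionVars false

section

variable {N M d : ℕ} [NeZero N] [NeZero M]

/-! ### Weyl operators and their composition law. -/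

/-- The Weyl operator `ψ ↦ (y ↦ κ(n₁ · n₂) e_N(n₂ · y) ψ(y + n₁))` for `n ∈ (ℤ/Mℤ)^{2d}`. -/
noncomputable def weylOp (κ : AddChar (ZMod M) ℂ) (h : N ∣ M) (n : Fin d ⊕ Fin d → ZMod M) :
    Module.End ℂ (StateSpace N d) where
  toFun ψ y := κ ((n ∘ Sum.inl) ⬝ᵥ (n ∘ Sum.inr)) *
    ZMod.stdAddChar ((ZMod.castHom h (ZMod N) ∘ n ∘ Sum.inr) ⬝ᵥ y) *
      ψ (y + ZMod.castHom h (ZMod N) ∘ n ∘ Sum.inl)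
  map_add' ψ φ := by ext y; simp only [Pi.add_apply]; ring
  map_smul' c ψ := by ext y; simp only [Pi.smul_apply, smul_eq_mul, RingHom.id_apply]; ring

/-- A character of `ℤ/Mℤ` that serves as the square root of `e_N` in Weyl operators. -/
structure IsHalfChar (κ : AddChar (ZMod M) ℂ) (h : N ∣ M) : Prop where
  two_mul : ∀ x, κ (2 * x) = ZMod.stdAddChar (ZMod.castHom h (ZMod N) x)
  mul_eq_one : ∀ x y, ZMod.castHom h (ZMod N) x = 0 → ZMod.castHom h (ZMod N) y = 0 → κ (x * y) = 1

/-- `U` intertwines `n ↦ T(nA)` with `n ↦ T(n)`. -/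
def Intertwines (κ : AddChar (ZMod M) ℂ) (h : N ∣ M)
    (A : Matrix (Fin d ⊕ Fin d) (Fin d ⊕ Fin d) (ZMod M)) (U : Module.End ℂ (StateSpace N d)) :
    Prop :=
  ∀ n, U * weylOp κ h (n ᵥ* A) = weylOp κ h n * U

variable {κ : AddChar (ZMod M) ℂ} {h : N ∣ M}

theorem weylOp_apply (n : Fin d ⊕ Fin d → ZMod M) (ψ : StateSpace N d) (y : Fin d → ZMod N) :
    weylOp κ h n ψ y = κ ((n ∘ Sum.inl) ⬝ᵥ (n ∘ Sum.inr)) *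
      ZMod.stdAddChar ((ZMod.castHom h (ZMod N) ∘ n ∘ Sum.inr) ⬝ᵥ y) *
        ψ (y + ZMod.castHom h (ZMod N) ∘ n ∘ Sum.inl) := rfl

theorem dotProduct_J_mulVec {R : Type*} [CommRing R] (n m : Fin d ⊕ Fin d → R) :
    n ⬝ᵥ (J (Fin d) R *ᵥ m) =
      (n ∘ Sum.inr) ⬝ᵥ (m ∘ Sum.inl) - (n ∘ Sum.inl) ⬝ᵥ (m ∘ Sum.inr) := by
  obtain ⟨n₁, n₂, rfl⟩ : ∃ a b, n = Sum.elim a b := ⟨_, _, (Sum.elim_comp_inl_inr n).symm⟩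
  obtain ⟨m₁, m₂, rfl⟩ : ∃ a b, m = Sum.elim a b := ⟨_, _, (Sum.elim_comp_inl_inr m).symm⟩
  rw [J, fromBlocks_mulVec, sumElim_dotProduct_sumElim]
  simp [neg_mulVec]
  ring

theorem comp_castHom_add {ι : Type*} (a b : ι → ZMod M) :
    ZMod.castHom h (ZMod N) ∘ (a + b) =
      ZMod.castHom h (ZMod N) ∘ a + ZMod.castHom h (ZMod N) ∘ b := by
  ext; simp only [Function.comp_apply, Pi.add_apply, map_add]

/-- Moving the translation by $n_1$ past the modulation by $m_2$ costs $e_N(m_2\cdot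
n_1)=\kappa(2\,m_2\cdot n_1)$. The half character $\kappa$ makes the remaining phase depend only on
the symplectic form. -/
theorem weylOp_mul (hκ : IsHalfChar κ h) (n m : Fin d ⊕ Fin d → ZMod M) :
    weylOp κ h n * weylOp κ h m =
      κ (-(n ⬝ᵥ (J (Fin d) (ZMod M) *ᵥ m))) • weylOp κ h (n + m) := by
  refine LinearMap.ext fun ψ => funext fun y => ?_
  simp only [Module.End.mul_apply, LinearMap.smul_apply, Pi.smul_apply, smul_eq_mul, weylOp_apply]
  set n₁ := n ∘ Sum.inl with hn₁
  set n₂ := n ∘ Sum.inr with hn₂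
  set m₁ := m ∘ Sum.inl with hm₁
  set m₂ := m ∘ Sum.inr with hm₂
  have e1 : (n + m) ∘ Sum.inl = n₁ + m₁ := rfl
  have e2 : (n + m) ∘ Sum.inr = n₂ + m₂ := rfl
  rw [e1, e2, dotProduct_J_mulVec, comp_castHom_add, comp_castHom_add, ← hn₁, ← hn₂, ← hm₁, ← hm₂]
  simp only [dotProduct_add, add_dotProduct, AddChar.map_add_eq_mul, add_assoc]
  rw [← RingHom.map_dotProduct, ← hκ.two_mul]
  have : κ (2 * (m₂ ⬝ᵥ n₁)) = κ (-(n₂ ⬝ᵥ m₁ - n₁ ⬝ᵥ m₂)) * κ (m₁ ⬝ᵥ n₂) * κ (n₁ ⬝ᵥ m₂) := by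
    rw [← AddChar.map_add_eq_mul, ← AddChar.map_add_eq_mul, dotProduct_comm m₁, dotProduct_comm m₂]
    congr 1; ring
  rw [this]; ring

theorem weylOp_zero : weylOp κ h (0 : Fin d ⊕ Fin d → ZMod M) = 1 := by
  refine LinearMap.ext fun ψ => funext fun y => ?_
  have e1 : ∀ f : Fin d → Fin d ⊕ Fin d, (0 : Fin d ⊕ Fin d → ZMod M) ∘ f = 0 := fun _ => rfl
  have e2 : ZMod.castHom h (ZMod N) ∘ (0 : Fin d → ZMod M) = 0 := by
    ext; simp only [Function.comp_apply, Pi.zero_apply, map_zero]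
  simp [weylOp_apply, e1, e2, -ZMod.castHom_apply]

theorem dotProduct_J_mulVec_self {R : Type*} [CommRing R] (n : Fin d ⊕ Fin d → R) :
    n ⬝ᵥ (J (Fin d) R *ᵥ n) = 0 := by
  rw [dotProduct_J_mulVec, dotProduct_comm, sub_self]

/-! ### Irreducibility and uniqueness of intertwiners. -/

theorem exists_comp_castHom_eq (h : N ∣ M) (v : Fin d → ZMod N) :
    ∃ w : Fin d → ZMod M, ZMod.castHom h (ZMod N) ∘ w = v := by
  choose w hw using fun i => ZMod.castHom_surjective h (v i)
  exact ⟨w, funext hw⟩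

theorem weylOp_elim_zero_apply (b : Fin d → ZMod M) (ψ : StateSpace N d) (y : Fin d → ZMod N) :
    weylOp κ h (Sum.elim 0 b) ψ y =
      ZMod.stdAddChar ((ZMod.castHom h (ZMod N) ∘ b) ⬝ᵥ y) * ψ y := by
  have e2 : ZMod.castHom h (ZMod N) ∘ (0 : Fin d → ZMod M) = 0 := by
    ext; simp only [Function.comp_apply, Pi.zero_apply, map_zero]
  rw [weylOp_apply, Sum.elim_comp_inl, Sum.elim_comp_inr, e2]
  simp

theorem weylOp_elim_apply_zero (a : Fin d → ZMod M) (ψ : StateSpace N d) (y : Fin d → ZMod N) :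
    weylOp κ h (Sum.elim a 0) ψ y = ψ (y + ZMod.castHom h (ZMod N) ∘ a) := by
  have e2 : ZMod.castHom h (ZMod N) ∘ (0 : Fin d → ZMod M) = 0 := by
    ext; simp only [Function.comp_apply, Pi.zero_apply, map_zero]
  rw [weylOp_apply, Sum.elim_comp_inl, Sum.elim_comp_inr, e2]
  simp

/-- Only the zero vector is orthogonal to everything under `e_N(b · y)`. -/
theorem eq_zero_of_stdAddChar_dotProduct {y : Fin d → ZMod N}
    (hy : ∀ b : Fin d → ZMod N, ZMod.stdAddChar (b ⬝ᵥ y) = (1 : ℂ)) : y = 0 := by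
  ext i
  have := hy (Pi.single i 1)
  rw [single_dotProduct, one_mul] at this
  exact ZMod.injective_stdAddChar (this.trans (AddChar.map_zero_eq_one _).symm)

theorem stateSpace_eq_sum (ψ : StateSpace N d) : ψ = ∑ y, ψ y • Pi.single y (1 : ℂ) := by
  ext x; simp [Finset.sum_apply, Pi.single_apply]

/-- Operators commuting with all Weyl operators are scalar. -/
theorem exists_eq_smul_one_of_commute {X : Module.End ℂ (StateSpace N d)}
    (hX : ∀ n, X * weylOp κ h n = weylOp κ h n * X) : ∃ c : ℂ, X = c • 1 := by
  -- Modulations fix the point mass at $0$, so its image under $X$ is supported at $0$. Translations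
  -- then carry this to every point mass, with the same scalar.
  have h0 : ∀ x, x ≠ 0 → X (Pi.single 0 1) x = 0 := by
    intro x hx
    by_contra hne
    refine hx (eq_zero_of_stdAddChar_dotProduct fun b => ?_)
    obtain ⟨b, rfl⟩ := exists_comp_castHom_eq h b
    have h1 : weylOp κ h (Sum.elim 0 b) (Pi.single 0 1) = (Pi.single 0 1 : StateSpace N d) := by
      ext y
      rw [weylOp_elim_zero_apply]
      rcases eq_or_ne y 0 with rfl | hy
      · simp
      · simp [Pi.single_eq_of_ne hy]
    have h2 := congrFun (LinearMap.congr_fun (hX (Sum.elim 0 b)) (Pi.single 0 1)) x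
    rw [Module.End.mul_apply, Module.End.mul_apply, h1, weylOp_elim_zero_apply] at h2
    exact mul_right_cancel₀ hne (by rw [← h2, one_mul])
  refine ⟨X (Pi.single 0 1) 0, ?_⟩
  have hs : ∀ y : Fin d → ZMod N, X (Pi.single y 1) = X (Pi.single 0 1) 0 • Pi.single y 1 := by
    intro y
    obtain ⟨a, ha⟩ := exists_comp_castHom_eq h (-y)
    have h1 : weylOp κ h (Sum.elim a 0) (Pi.single 0 1) = (Pi.single y 1 : StateSpace N d) := by
      ext x
      rw [weylOp_elim_apply_zero, ha, Pi.single_apply, Pi.single_apply]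
      simp only [add_neg_eq_zero]
    have h2 := LinearMap.congr_fun (hX (Sum.elim a 0)) (Pi.single 0 1)
    rw [Module.End.mul_apply, Module.End.mul_apply, h1] at h2
    ext x
    rw [h2, weylOp_elim_apply_zero, ha, Pi.smul_apply, Pi.single_apply]
    split_ifs with hx
    · rw [hx, add_neg_cancel, smul_eq_mul, mul_one]
    · rw [h0 _ (by rwa [ne_eq, add_neg_eq_zero]), smul_zero]
  apply LinearMap.ext
  intro ψ
  conv_lhs => rw [stateSpace_eq_sum ψ]
  conv_rhs => rw [stateSpace_eq_sum ψ]
  rw [map_sum, map_sum]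
  refine Finset.sum_congr rfl fun y _ => ?_
  rw [map_smul, map_smul, hs, LinearMap.smul_apply, Module.End.one_apply]

/-- Uniqueness of intertwiners up to a scalar. -/
theorem Intertwines.exists_eq_smul {A : Matrix (Fin d ⊕ Fin d) (Fin d ⊕ Fin d) (ZMod M)}
    {X Y : Module.End ℂ (StateSpace N d)} (hX : Intertwines κ h A X) (hY : Intertwines κ h A Y)
    (hb : Function.Bijective Y) : ∃ c : ℂ, X = c • Y := by
  let e := LinearEquiv.ofBijective Y hb
  let Z : Module.End ℂ (StateSpace N d) := e.symm.toLinearMap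
  have h1 : Y * Z = 1 := LinearMap.ext fun ψ => e.apply_symm_apply ψ
  have h2 : Z * Y = 1 := LinearMap.ext fun ψ => e.symm_apply_apply ψ
  obtain ⟨c, hc⟩ := exists_eq_smul_one_of_commute (κ := κ) (h := h) (X := X * Z) fun n => by
    have hz : Z * weylOp κ h n = weylOp κ h (n ᵥ* A) * Z := by
      calc Z * weylOp κ h n = Z * (weylOp κ h n * Y) * Z := by
            rw [mul_assoc, mul_assoc, h1, mul_one]
        _ = _ := by rw [← hY n, ← mul_assoc Z, h2, one_mul]
    rw [mul_assoc, hz, ← mul_assoc, hX n, mul_assoc]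
  refine ⟨c, ?_⟩
  calc X = X * Z * Y := by rw [mul_assoc, h2, mul_one]
    _ = _ := by rw [hc, smul_mul_assoc, one_mul]

theorem Intertwines.mul {A B : Matrix (Fin d ⊕ Fin d) (Fin d ⊕ Fin d) (ZMod M)}
    {X Y : Module.End ℂ (StateSpace N d)} (hX : Intertwines κ h A X) (hY : Intertwines κ h B Y) :
    Intertwines κ h (A * B) (X * Y) := fun n => by
  rw [← vecMul_vecMul, mul_assoc, hY, ← mul_assoc, hX, mul_assoc]

theorem Intertwines.smul {A : Matrix (Fin d ⊕ Fin d) (Fin d ⊕ Fin d) (ZMod M)}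
    {X : Module.End ℂ (StateSpace N d)} (hX : Intertwines κ h A X) (c : ℂ) :
    Intertwines κ h A (c • X) := fun n => by
  rw [smul_mul_assoc, mul_smul_comm, hX]

/-! ### Unitarity of intertwiners. -/

theorem norm_weylOp_sum (n : Fin d ⊕ Fin d → ZMod M) (ψ φ : StateSpace N d) :
    ∑ x, weylOp κ h n ψ x * (starRingEnd ℂ) (weylOp κ h n φ x) =
      ∑ x, ψ x * (starRingEnd ℂ) (φ x) := by
  rw [← Equiv.sum_comp (Equiv.addRight (ZMod.castHom h (ZMod N) ∘ n ∘ Sum.inl))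
    fun x => ψ x * (starRingEnd ℂ) (φ x)]
  refine Finset.sum_congr rfl fun x _ => ?_
  simp only [weylOp_apply, map_mul, Equiv.coe_addRight]
  have h1 : ∀ z : ℂ, ‖z‖ = 1 → z * (starRingEnd ℂ) z = 1 := fun z hz => by
    rw [Complex.mul_conj, Complex.normSq_eq_norm_sq, hz]; norm_num
  have e1 := h1 _ (κ.norm_apply ((n ∘ Sum.inl) ⬝ᵥ (n ∘ Sum.inr)))
  have e2 := h1 _ ((ZMod.stdAddChar (N := N)).norm_apply
    ((ZMod.castHom h (ZMod N) ∘ n ∘ Sum.inr) ⬝ᵥ x))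
  linear_combination (ψ (x + ZMod.castHom h (ZMod N) ∘ n ∘ Sum.inl) *
    (starRingEnd ℂ) (φ (x + ZMod.castHom h (ZMod N) ∘ n ∘ Sum.inl))) * (e1 *
      (ZMod.stdAddChar ((ZMod.castHom h (ZMod N) ∘ n ∘ Sum.inr) ⬝ᵥ x) * (starRingEnd ℂ)
      (ZMod.stdAddChar ((ZMod.castHom h (ZMod N) ∘ n ∘ Sum.inr) ⬝ᵥ x))) + e2)

theorem isUnitaryOperator_of_sum_eq {U : Module.End ℂ (StateSpace N d)}
    (hU : ∀ ψ φ : StateSpace N d, ∑ x, U ψ x * (starRingEnd ℂ) (U φ x) =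
      ∑ x, ψ x * (starRingEnd ℂ) (φ x)) : IsUnitaryOperator U := by
  refine ⟨?_, fun ψ φ => by rw [stateInner, stateInner, hU]⟩
  have hinj : Function.Injective U := by
    rw [injective_iff_map_eq_zero]
    intro ψ hψ
    have h1 := hU ψ ψ
    simp only [hψ, Pi.zero_apply, zero_mul, Finset.sum_const_zero, Complex.mul_conj] at h1
    rw [← Complex.ofReal_sum, eq_comm, Complex.ofReal_eq_zero,
      Finset.sum_eq_zero_iff_of_nonneg fun _ _ => Complex.normSq_nonneg _] at h1
    ext x
    exact Complex.normSq_eq_zero.1 (h1 x (Finset.mem_univ x))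
  exact ⟨hinj, LinearMap.injective_iff_surjective.1 hinj⟩

theorem weylOp_elim_zero_single (b : Fin d → ZMod M) (y : Fin d → ZMod N) :
    weylOp κ h (Sum.elim 0 b) (Pi.single y 1) =
      (ZMod.stdAddChar ((ZMod.castHom h (ZMod N) ∘ b) ⬝ᵥ y) : ℂ) •
        (Pi.single y 1 : StateSpace N d) := by
  ext x
  rw [weylOp_elim_zero_apply, Pi.smul_apply, smul_eq_mul]
  rcases eq_or_ne x y with rfl | hy
  · rfl
  · simp [Pi.single_eq_of_ne hy]

theorem weylOp_elim_single_zero (a : Fin d → ZMod M) :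
    weylOp κ h (Sum.elim a 0) (Pi.single 0 1) =
      (Pi.single (-(ZMod.castHom h (ZMod N) ∘ a)) 1 : StateSpace N d) := by
  ext x
  rw [weylOp_elim_apply_zero, Pi.single_apply, Pi.single_apply]
  simp only [add_eq_zero_iff_eq_neg]

theorem apply_eq_sum (X : Module.End ℂ (StateSpace N d)) (ψ : StateSpace N d)
    (x : Fin d → ZMod N) : X ψ x = ∑ y, ψ y * X (Pi.single y 1) x := by
  conv_lhs => rw [stateSpace_eq_sum ψ]
  rw [map_sum, Finset.sum_apply]
  exact Finset.sum_congr rfl fun y _ => by rw [map_smul, Pi.smul_apply, smul_eq_mul]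

/-- An intertwiner is a multiple of an isometry. -/
theorem Intertwines.sum_mul_conj {A B : Matrix (Fin d ⊕ Fin d) (Fin d ⊕ Fin d) (ZMod M)}
    (hBA : B * A = 1) {X : Module.End ℂ (StateSpace N d)} (hX : Intertwines κ h A X)
    (ψ φ : StateSpace N d) :
    ∑ x, X ψ x * (starRingEnd ℂ) (X φ x) =
      (∑ x, X (Pi.single 0 1) x * (starRingEnd ℂ) (X (Pi.single 0 1) x)) *
        ∑ x, ψ x * (starRingEnd ℂ) (φ x) := by
  -- The pulled-back form is invariant under all Weyl operators. Modulations force distinct point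
  -- masses to be orthogonal, and translations give them equal norms.
  let S : StateSpace N d → StateSpace N d → ℂ :=
    fun ψ φ => ∑ x, X ψ x * (starRingEnd ℂ) (X φ x)
  have hS : ∀ n ψ φ, S (weylOp κ h n ψ) (weylOp κ h n φ) = S ψ φ := by
    intro n ψ φ
    have h1 : ∀ ψ, X (weylOp κ h n ψ) = weylOp κ h (n ᵥ* B) (X ψ) := fun ψ => by
      have := LinearMap.congr_fun (hX (n ᵥ* B)) ψ
      rwa [vecMul_vecMul, hBA, vecMul_one] at this
    simp only [S, h1, norm_weylOp_sum]
  have hd : ∀ y y', S (Pi.single y 1) (Pi.single y' 1) =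
      if y = y' then S (Pi.single 0 1) (Pi.single 0 1) else 0 := by
    intro y y'
    split_ifs with hy
    · subst hy
      obtain ⟨a, ha⟩ := exists_comp_castHom_eq h (-y)
      rw [← hS (Sum.elim a 0) (Pi.single 0 1), weylOp_elim_single_zero, ha, neg_neg]
    · by_contra hne
      refine hy (sub_eq_zero.1 (eq_zero_of_stdAddChar_dotProduct fun b => ?_))
      obtain ⟨b, rfl⟩ := exists_comp_castHom_eq h b
      have h1 := hS (Sum.elim 0 b) (Pi.single y 1) (Pi.single y' 1)
      rw [weylOp_elim_zero_single, weylOp_elim_zero_single] at h1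
      refine mul_right_cancel₀ hne ?_
      rw [one_mul]
      conv_rhs => rw [← h1]
      rw [dotProduct_sub, sub_eq_add_neg, AddChar.map_add_eq_mul, AddChar.map_neg_eq_conj]
      simp only [S, map_smul, Pi.smul_apply, smul_eq_mul, map_mul, Finset.mul_sum]
      exact Finset.sum_congr rfl fun x _ => by ring
  have : ∑ x, X ψ x * (starRingEnd ℂ) (X φ x) =
      ∑ y, ∑ y', ψ y * (starRingEnd ℂ) (φ y') * S (Pi.single y 1) (Pi.single y' 1) := by
    simp only [apply_eq_sum X ψ, apply_eq_sum X φ, S, map_sum, map_mul, Finset.sum_mul,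
      Finset.mul_sum]
    rw [Finset.sum_comm, Finset.sum_congr rfl fun y _ => Finset.sum_comm, Finset.sum_comm]
    refine Finset.sum_congr rfl fun y _ => Finset.sum_congr rfl fun y' _ =>
      Finset.sum_congr rfl fun x _ => ?_
    ring
  rw [this, Finset.mul_sum]
  refine Finset.sum_congr rfl fun y _ => ?_
  rw [Finset.sum_congr rfl fun y' _ => by rw [hd y y', mul_ite, mul_zero], Finset.sum_ite_eq,
    if_pos (Finset.mem_univ y), mul_comm]

theorem Intertwines.exists_isUnitaryOperator
    {A B : Matrix (Fin d ⊕ Fin d) (Fin d ⊕ Fin d) (ZMod M)}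
    (hBA : B * A = 1) {X : Module.End ℂ (StateSpace N d)} (hX : Intertwines κ h A X)
    (hne : X ≠ 0) : ∃ U, IsUnitaryOperator U ∧ Intertwines κ h A U := by
  set c : ℂ := ∑ x, X (Pi.single 0 1) x * (starRingEnd ℂ) (X (Pi.single 0 1) x) with hc
  set r : ℝ := ∑ x, Complex.normSq (X (Pi.single 0 1) x) with hr
  have hcr : c = r := by simp [hc, hr, Complex.mul_conj]
  have hr0 : 0 ≤ r := Finset.sum_nonneg fun _ _ => Complex.normSq_nonneg _
  have hr1 : r ≠ 0 := by
    intro h0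
    refine hne (LinearMap.ext fun ψ => funext fun x => ?_)
    have h1 := hX.sum_mul_conj hBA ψ ψ
    rw [← hc, hcr, h0, Complex.ofReal_zero, zero_mul] at h1
    simp only [Complex.mul_conj] at h1
    rw [← Complex.ofReal_sum, Complex.ofReal_eq_zero,
      Finset.sum_eq_zero_iff_of_nonneg fun _ _ => Complex.normSq_nonneg _] at h1
    exact Complex.normSq_eq_zero.1 (h1 x (Finset.mem_univ x))
  refine ⟨(((Real.sqrt r)⁻¹ : ℝ) : ℂ) • X, isUnitaryOperator_of_sum_eq fun ψ φ => ?_, hX.smul _⟩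
  have h2 := hX.sum_mul_conj hBA ψ φ
  rw [← hc, hcr] at h2
  have h3 : (((Real.sqrt r)⁻¹ : ℝ) : ℂ) * (((Real.sqrt r)⁻¹ : ℝ) : ℂ) * r = 1 := by
    rw [← Complex.ofReal_mul, ← mul_inv, Real.mul_self_sqrt hr0, ← Complex.ofReal_mul,
      inv_mul_cancel₀ hr1, Complex.ofReal_one]
  calc _ = (((Real.sqrt r)⁻¹ : ℝ) : ℂ) * (((Real.sqrt r)⁻¹ : ℝ) : ℂ) *
        ∑ x, X ψ x * (starRingEnd ℂ) (X φ x) := by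
        rw [Finset.mul_sum]
        refine Finset.sum_congr rfl fun x _ => ?_
        rw [LinearMap.smul_apply, LinearMap.smul_apply, Pi.smul_apply, Pi.smul_apply, smul_eq_mul,
          smul_eq_mul, map_mul, Complex.conj_ofReal]
        ring
    _ = _ := by rw [h2, ← mul_assoc, h3, one_mul]

/-! ### Existence of intertwiners. -/

/-- Averages over the Weyl operators are intertwiners. -/
theorem intertwines_sum (hκ : IsHalfChar κ h)
    {A : Matrix (Fin d ⊕ Fin d) (Fin d ⊕ Fin d) (ZMod M)}
    (hA : A ∈ symplecticGroup (Fin d) (ZMod M)) (Y : Module.End ℂ (StateSpace N d)) :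
    Intertwines κ h A (∑ k, weylOp κ h k * Y * weylOp κ h (-(k ᵥ* A))) := by
  intro n
  have hJ : ∀ k, (k ᵥ* A) ⬝ᵥ (J (Fin d) (ZMod M) *ᵥ (n ᵥ* A)) =
      k ⬝ᵥ (J (Fin d) (ZMod M) *ᵥ n) := fun k => by
    rw [← mulVec_transpose A n, mulVec_mulVec, ← dotProduct_mulVec, mulVec_mulVec,
      ← Matrix.mul_assoc, SymplecticGroup.mem_iff.1 hA]
  have hs : ∀ k, n ⬝ᵥ (J (Fin d) (ZMod M) *ᵥ k) = -(k ⬝ᵥ (J (Fin d) (ZMod M) *ᵥ n)) := fun k => by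
    rw [dotProduct_J_mulVec, dotProduct_J_mulVec, dotProduct_comm (n ∘ Sum.inr),
      dotProduct_comm (n ∘ Sum.inl)]
    ring
  -- Shift the summation variable by $n$ on one side. The phases of $T(n)T(k)$ and of
  -- $T(-(n+k)A)\,T(nA)$ agree because $A$ preserves the symplectic form.
  rw [Finset.sum_mul, Finset.mul_sum, ← Equiv.sum_comp (Equiv.addLeft n)]
  refine Finset.sum_congr rfl fun k _ => ?_
  have h1 := weylOp_mul hκ n k
  have h2 := weylOp_mul hκ (-((n + k) ᵥ* A)) (n ᵥ* A)
  have e : -((n + k) ᵥ* A) + n ᵥ* A = -(k ᵥ* A) := by rw [add_vecMul]; abel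
  rw [e, neg_dotProduct, neg_neg, add_vecMul, add_dotProduct, dotProduct_J_mulVec_self,
    zero_add, hJ] at h2
  rw [hs, neg_neg] at h1
  rw [Equiv.coe_addLeft, mul_assoc, add_vecMul, h2, mul_smul_comm, ← mul_assoc (weylOp κ h n),
    ← mul_assoc (weylOp κ h n), h1, smul_mul_assoc, smul_mul_assoc]

theorem sum_stdAddChar_dotProduct {v : Fin d → ZMod N} (hv : v ≠ 0) :
    ∑ u : Fin d → ZMod N, (ZMod.stdAddChar (v ⬝ᵥ u) : ℂ) = 0 := by
  by_contra hne
  refine hv (eq_zero_of_stdAddChar_dotProduct fun w => mul_right_cancel₀ hne ?_)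
  rw [one_mul, Finset.mul_sum]
  conv_rhs => rw [← Equiv.sum_comp (Equiv.addRight w)]
  refine Finset.sum_congr rfl fun u _ => ?_
  rw [Equiv.coe_addRight, dotProduct_add, AddChar.map_add_eq_mul, dotProduct_comm w, mul_comm]

theorem trace_weylOp (hκ : IsHalfChar κ h) (k : Fin d ⊕ Fin d → ZMod M) :
    ∑ u : Fin d → ZMod N, weylOp κ h k (Pi.single u 1) u =
      if ZMod.castHom h (ZMod N) ∘ k = 0 then (N : ℂ) ^ d else 0 := by
  have h1 : ∀ u : Fin d → ZMod N, weylOp κ h k (Pi.single u 1) u =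
      if ZMod.castHom h (ZMod N) ∘ k ∘ Sum.inl = 0 then κ ((k ∘ Sum.inl) ⬝ᵥ (k ∘ Sum.inr)) *
        ZMod.stdAddChar ((ZMod.castHom h (ZMod N) ∘ k ∘ Sum.inr) ⬝ᵥ u) else 0 := by
    intro u
    rw [weylOp_apply, Pi.single_apply]
    simp only [add_eq_left, mul_ite, mul_one, mul_zero]
  simp only [h1]
  by_cases hl : ZMod.castHom h (ZMod N) ∘ k ∘ Sum.inl = 0
  · simp only [if_pos hl, ← Finset.mul_sum]
    by_cases hr : ZMod.castHom h (ZMod N) ∘ k ∘ Sum.inr = 0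
    · have h0 : ZMod.castHom h (ZMod N) ∘ k = 0 := by
        ext i
        rcases i with i | i
        · exact congrFun hl i
        · exact congrFun hr i
      have h2 : κ ((k ∘ Sum.inl) ⬝ᵥ (k ∘ Sum.inr)) = 1 := by
        exact Finset.sum_induction _ (fun z => κ z = 1)
          (fun a b ha hb => by rw [AddChar.map_add_eq_mul, ha, hb, one_mul])
          (AddChar.map_zero_eq_one κ)
          fun i _ => hκ.mul_eq_one _ _ (congrFun hl i) (congrFun hr i)
      rw [if_pos h0, h2, hr]
      simp
    · rw [sum_stdAddChar_dotProduct hr, mul_zero, if_neg]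
      intro h0
      exact hr (funext fun i => congrFun h0 (Sum.inr i))
  · simp only [if_neg hl, Finset.sum_const_zero]
    rw [if_neg]
    intro h0
    exact hl (funext fun i => congrFun h0 (Sum.inl i))

/-- If the averages of all matrix units vanished, summing suitable entries would give $\sum_k
\operatorname{tr}T(k)\operatorname{tr}T(-kA)=0$. But only the $k\equiv0$ modulo $N$ contribute, each
with $N^{2d}$. -/
theorem exists_intertwiner_ne_zero (hκ : IsHalfChar κ h)
    {A : Matrix (Fin d ⊕ Fin d) (Fin d ⊕ Fin d) (ZMod M)}
    (hA : A ∈ symplecticGroup (Fin d) (ZMod M)) :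
    ∃ X : Module.End ℂ (StateSpace N d), X ≠ 0 ∧ Intertwines κ h A X := by
  classical
  let Y : (Fin d → ZMod N) → (Fin d → ZMod N) → Module.End ℂ (StateSpace N d) :=
    fun u v => (LinearMap.proj v : StateSpace N d →ₗ[ℂ] ℂ).smulRight (Pi.single u 1)
  by_contra! hX
  have h0 : ∀ u v, ∑ k, weylOp κ h k * Y u v * weylOp κ h (-(k ᵥ* A)) = 0 := fun u v => by
    by_contra hne
    exact hX _ hne (intertwines_sum hκ hA (Y u v))
  have h1 : ∀ u v, ∑ k, weylOp κ h k (Pi.single u 1) u *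
      weylOp κ h (-(k ᵥ* A)) (Pi.single v 1) v = 0 := fun u v => by
    have h2 := congrFun (LinearMap.congr_fun (h0 u v) (Pi.single v 1)) u
    rw [LinearMap.sum_apply, Finset.sum_apply] at h2
    refine Eq.trans (Finset.sum_congr rfl fun k _ => ?_) h2
    simp only [Module.End.mul_apply, Y, LinearMap.smulRight_apply, LinearMap.proj_apply, map_smul,
      Pi.smul_apply, smul_eq_mul]
    ring
  have h2 : ∑ k, (∑ u, weylOp κ h k (Pi.single u 1) u) *
      (∑ v, weylOp κ h (-(k ᵥ* A)) (Pi.single v 1) v) = 0 := by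
    calc _ = ∑ u, ∑ v, ∑ k, weylOp κ h k (Pi.single u 1) u *
          weylOp κ h (-(k ᵥ* A)) (Pi.single v 1) v := by
          simp only [Finset.sum_mul_sum]
          rw [Finset.sum_comm]
          exact Finset.sum_congr rfl fun u _ => Finset.sum_comm
      _ = 0 := by simp only [h1, Finset.sum_const_zero]
  have h3 : ∀ k : Fin d ⊕ Fin d → ZMod M, (∑ u, weylOp κ h k (Pi.single u 1) u) *
      (∑ v, weylOp κ h (-(k ᵥ* A)) (Pi.single v 1) v) =
        if ZMod.castHom h (ZMod N) ∘ k = 0 then (N : ℂ) ^ d * (N : ℂ) ^ d else 0 := by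
    intro k
    rw [trace_weylOp hκ, trace_weylOp hκ]
    by_cases hk : ZMod.castHom h (ZMod N) ∘ k = 0
    · have : ZMod.castHom h (ZMod N) ∘ (-(k ᵥ* A)) = 0 := by
        ext i
        have e : ∀ j, ZMod.castHom h (ZMod N) (k j) = 0 := fun j => congrFun hk j
        simp only [Function.comp_apply, Pi.neg_apply, map_neg, vecMul, dotProduct, map_sum, map_mul,
          e, zero_mul, Finset.sum_const_zero, neg_zero, Pi.zero_apply]
      rw [if_pos hk, if_pos hk, if_pos this]
    · rw [if_neg hk, if_neg hk, zero_mul]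
  simp only [h3] at h2
  rw [← Finset.sum_filter, Finset.sum_const, nsmul_eq_mul] at h2
  have hN : (N : ℂ) ≠ 0 := Nat.cast_ne_zero.2 (NeZero.ne N)
  have hcard : ((Finset.univ.filter
      fun k : Fin d ⊕ Fin d → ZMod M => ZMod.castHom h (ZMod N) ∘ k = 0).card : ℂ) ≠ 0 := by
    rw [Nat.cast_ne_zero, Finset.card_ne_zero]
    refine ⟨0, Finset.mem_filter.2 ⟨Finset.mem_univ _, ?_⟩⟩
    ext
    simp only [Function.comp_apply, Pi.zero_apply, map_zero]
  exact mul_ne_zero hcard (mul_ne_zero (pow_ne_zero _ hN) (pow_ne_zero _ hN)) h2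

theorem exists_unitary_intertwiner (hκ : IsHalfChar κ h)
    (A : symplecticGroup (Fin d) (ZMod M)) :
    ∃ U : Module.End ℂ (StateSpace N d), IsUnitaryOperator U ∧
      Intertwines κ h (A : Matrix (Fin d ⊕ Fin d) (Fin d ⊕ Fin d) (ZMod M)) U := by
  obtain ⟨X, hne, hX⟩ := exists_intertwiner_ne_zero (d := d) hκ A.2
  refine hX.exists_isUnitaryOperator
    (B := ((A⁻¹ : symplecticGroup (Fin d) (ZMod M)) : Matrix _ _ _)) ?_ hne
  rw [← Submonoid.coe_mul, inv_mul_cancel, Submonoid.coe_one]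

/-! ### Removing the cocycle by determinants. -/

/-- A projective representation preserving two subspaces whose dimensions differ by one can be
rescaled to a representation, by the quotient of the determinants on the two subspaces. -/
theorem exists_monoidHom_of_projective {G V : Type*} [Group G] [AddCommGroup V] [Module ℂ V]
    [FiniteDimensional ℂ V] (U : G → Module.End ℂ V) (hU : ∀ g, Function.Injective (U g))
    (hmul : ∀ g k, ∃ c : ℂ, U g * U k = c • U (g * k)) (E F : Submodule ℂ V)
    (hE : ∀ g, ∀ v ∈ E, U g v ∈ E) (hF : ∀ g, ∀ v ∈ F, U g v ∈ F)
    (hd : Module.finrank ℂ E = Module.finrank ℂ F + 1) :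
    ∃ (c : G → ℂ) (ρ : G →* Module.End ℂ V), ∀ g, ρ g = c g • U g := by
  have key : ∀ (K : Submodule ℂ V) (hK : ∀ g, ∀ v ∈ K, U g v ∈ K),
      (∀ g, LinearMap.det ((U g).restrict (hK g)) ≠ 0) ∧
      ∀ g k (c : ℂ), U g * U k = c • U (g * k) →
        LinearMap.det ((U g).restrict (hK g)) * LinearMap.det ((U k).restrict (hK k)) =
          c ^ Module.finrank ℂ K * LinearMap.det ((U (g * k)).restrict (hK (g * k))) := by
    intro K hK
    constructor
    · intro g
      have hinj : Function.Injective ((U g).restrict (hK g)) := fun v w hvw =>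
        Subtype.ext (hU g (congrArg Subtype.val hvw))
      exact (LinearEquiv.isUnit_det' (LinearEquiv.ofInjectiveEndo _ hinj)).ne_zero
    · intro g k c hc
      rw [← map_mul, ← LinearMap.det_smul]
      congr 1
      refine LinearMap.ext fun v => Subtype.ext ?_
      exact LinearMap.congr_fun hc v
  obtain ⟨hE0, hE1⟩ := key E hE
  obtain ⟨hF0, hF1⟩ := key F hF
  set a : G → ℂ := fun g => LinearMap.det ((U g).restrict (hE g)) with ha
  set b : G → ℂ := fun g => LinearMap.det ((U g).restrict (hF g)) with hb
  have hmul' : ∀ g k, ((b (g * k) / a (g * k)) • U (g * k)) =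
      ((b g / a g) • U g) * ((b k / a k) • U k) := by
    intro g k
    obtain ⟨c, hc⟩ := hmul g k
    have h1 : a g * a k = c ^ (Module.finrank ℂ F + 1) * a (g * k) := hd ▸ hE1 g k c hc
    have h2 : b g * b k = c ^ Module.finrank ℂ F * b (g * k) := hF1 g k c hc
    have hc0 : c ≠ 0 := by
      rintro rfl
      rw [zero_pow (Nat.succ_ne_zero _), zero_mul] at h1
      exact mul_ne_zero (hE0 g) (hE0 k) h1
    rw [smul_mul_smul_comm, hc, smul_smul, div_mul_div_comm, h1, h2]
    congr 1
    have := hE0 (g * k)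
    change a (g * k) ≠ 0 at this
    field_simp
    ring
  -- The rescaled operator at $1$ is idempotent and injective, hence the identity.
  have hone : (b 1 / a 1) • U 1 = 1 := by
    have h1 := hmul' 1 1
    rw [mul_one] at h1
    have hinj : Function.Injective ((b 1 / a 1) • U 1) := fun v w hvw =>
      hU 1 (smul_right_injective V (div_ne_zero (hF0 1) (hE0 1)) hvw)
    refine LinearMap.ext fun v => hinj ?_
    exact (LinearMap.congr_fun h1 v).symm
  exact ⟨fun g => b g / a g,
    { toFun := fun g => (b g / a g) • U g, map_one' := hone, map_mul' := hmul' }, fun g => rfl⟩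

/-! ### Scalars between unitary operators. -/

theorem stateInner_self_ne_zero : stateInner (Pi.single 0 1 : StateSpace N d) (Pi.single 0 1) ≠ 0 := by
  have hN : (N : ℂ) ≠ 0 := Nat.cast_ne_zero.2 (NeZero.ne N)
  simp [stateInner, Pi.single_apply, hN]

theorem stateInner_smul_smul (c : ℂ) (ψ φ : StateSpace N d) :
    stateInner (c • ψ) (c • φ) = (‖c‖ : ℂ) ^ 2 * stateInner ψ φ := by
  simp only [stateInner, Pi.smul_apply, smul_eq_mul, map_mul, Finset.mul_sum, ← Complex.mul_conj']
  exact Finset.sum_congr rfl fun x _ => by ring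

theorem IsUnitaryOperator.smul {U : Module.End ℂ (StateSpace N d)} (hU : IsUnitaryOperator U)
    {c : ℂ} (hc : ‖c‖ = 1) : IsUnitaryOperator (c • U) := by
  have hc0 : c ≠ 0 := norm_ne_zero_iff.1 (by rw [hc]; exact one_ne_zero)
  refine ⟨⟨fun v w hvw => hU.1.1 (smul_right_injective _ hc0 hvw), fun v => ?_⟩, fun ψ φ => ?_⟩
  · obtain ⟨w, hw⟩ := hU.1.2 (c⁻¹ • v)
    exact ⟨w, by rw [LinearMap.smul_apply, hw, smul_inv_smul₀ hc0]⟩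
  · rw [LinearMap.smul_apply, LinearMap.smul_apply, stateInner_smul_smul, hc, hU.2]
    simp

theorem norm_eq_one_of_isUnitaryOperator_smul {U : Module.End ℂ (StateSpace N d)}
    (hU : IsUnitaryOperator U) {c : ℂ} (hc : IsUnitaryOperator (c • U)) : ‖c‖ = 1 := by
  have h1 := hc.2 (Pi.single 0 1) (Pi.single 0 1)
  rw [LinearMap.smul_apply, stateInner_smul_smul, hU.2] at h1
  have h2 := mul_right_cancel₀ stateInner_self_ne_zero (h1.trans (one_mul _).symm)
  exact (pow_eq_one_iff_of_nonneg (norm_nonneg c) two_ne_zero).1 (by exact_mod_cast h2)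

/-- A multiple of a unitary operator that has finite order is unitary. -/
theorem norm_eq_one_of_smul_pow_eq_one {U : Module.End ℂ (StateSpace N d)}
    (hU : IsUnitaryOperator U) {c : ℂ} {n : ℕ} (hn : n ≠ 0) (hc : (c • U) ^ n = 1) : ‖c‖ = 1 := by
  have h1 : ∀ k (ψ : StateSpace N d), stateInner (((c • U) ^ k) ψ) (((c • U) ^ k) ψ) =
      ((‖c‖ : ℂ) ^ 2) ^ k * stateInner ψ ψ := by
    intro k
    induction k with
    | zero => intro ψ; simp
    | succ k ih =>
      intro ψ
      rw [pow_succ, Module.End.mul_apply, ih, LinearMap.smul_apply, stateInner_smul_smul, hU.2]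
      ring
  have h2 := h1 n (Pi.single 0 1)
  rw [hc, Module.End.one_apply] at h2
  have h3 := mul_right_cancel₀ stateInner_self_ne_zero ((one_mul _).trans h2)
  rw [← pow_mul] at h3
  exact (pow_eq_one_iff_of_nonneg (norm_nonneg c) (mul_ne_zero two_ne_zero hn)).1
    (by exact_mod_cast h3.symm)

/-! ### The coset space and its even and odd parts. -/

/-- The functions supported on the `y` with `qm y = 0` and invariant under the `z` with `qz = 0`. -/
def cosetSpace (N d q m : ℕ) : Submodule ℂ (StateSpace N d) where
  carrier := {ψ | (∀ y, ψ y ≠ 0 → (q * m) • y = 0) ∧ ∀ y z, q • z = 0 → ψ (y + z) = ψ y}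
  zero_mem' := ⟨fun _ h => absurd rfl h, fun _ _ _ => rfl⟩
  add_mem' {ψ φ} hψ hφ := by
    refine ⟨fun y hy => ?_, fun y z hz => ?_⟩
    · by_cases h0 : ψ y = 0
      · refine hφ.1 y fun h1 => hy ?_
        rw [Pi.add_apply, h0, h1, add_zero]
      · exact hψ.1 y h0
    · rw [Pi.add_apply, Pi.add_apply, hψ.2 y z hz, hφ.2 y z hz]
  smul_mem' c ψ hψ := by
    refine ⟨fun y hy => hψ.1 y fun h0 => hy ?_, fun y z hz => ?_⟩
    · rw [Pi.smul_apply, h0, smul_zero]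
    · rw [Pi.smul_apply, Pi.smul_apply, hψ.2 y z hz]

/-- The parity operator `ψ(y) ↦ ψ(-y)`. -/
def parityOp (N d : ℕ) : Module.End ℂ (StateSpace N d) where
  toFun ψ y := ψ (-y)
  map_add' _ _ := rfl
  map_smul' _ _ := rfl

/-- The eigenspace of the parity operator in the coset space. -/
def paritySpace (N d q m : ℕ) (ε : ℂ) : Submodule ℂ (StateSpace N d) :=
  cosetSpace N d q m ⊓ Module.End.eigenspace (parityOp N d) ε

theorem mem_paritySpace {q m : ℕ} {ε : ℂ} {ψ : StateSpace N d} :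
    ψ ∈ paritySpace N d q m ε ↔ ψ ∈ cosetSpace N d q m ∧ ∀ y, ψ (-y) = ε * ψ y := by
  rw [paritySpace, Submodule.mem_inf, Module.End.mem_eigenspace_iff, funext_iff]
  rfl

/-- Enumerate the group and compare the positions of $v$ and $-v$. -/
theorem exists_odd_sign (V : Type*) [AddGroup V] [Finite V] :
    ∃ g : V → ℂ, (∀ v, g (-v) = -g v) ∧ ∀ v, v ≠ -v → g v * g v = 1 := by
  obtain ⟨n, ⟨e⟩⟩ := Finite.exists_equiv_fin V
  refine ⟨fun v => if e v < e (-v) then 1 else if e (-v) < e v then -1 else 0, fun v => ?_,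
    fun v hv => ?_⟩
  · simp only [neg_neg]
    rcases lt_trichotomy (e v) (e (-v)) with h1 | h1 | h1
    · simp [h1, h1.not_gt]
    · simp [h1]
    · simp [h1, h1.not_gt]
  · rcases lt_trichotomy (e v) (e (-v)) with h1 | h1 | h1
    · simp [h1]
    · exact absurd (e.injective h1) hv
    · simp [h1, h1.not_gt]

/-- Multiplication by an odd sign function of $qy$ exchanges even and odd functions. It loses only
the value on the zero coset, which is the extra dimension. Since $m$ is odd, no other coset in the
support is its own negative. -/
theorem finrank_paritySpace_one {q m : ℕ} (hm : Odd m) :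
    Module.finrank ℂ (paritySpace N d q m 1) = Module.finrank ℂ (paritySpace N d q m (-1)) + 1 := by
  classical
  obtain ⟨g, hg1, hg2⟩ := exists_odd_sign (Fin d → ZMod N)
  let σ : (Fin d → ZMod N) → ℂ := fun y => g (q • y)
  have hσ0 : ∀ y, q • y = 0 → σ y = 0 := fun y hy => by
    have := hg1 0
    rw [neg_zero, self_eq_neg] at this
    simp only [σ, hy, this]
  have hσ1 : ∀ y, σ (-y) = -σ y := fun y => by simp only [σ, smul_neg, hg1]
  have hσ2 : ∀ y z, q • z = 0 → σ (y + z) = σ y := fun y z hz => by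
    simp only [σ, smul_add, hz, add_zero]
  have hσ3 : ∀ y, (q * m) • y = 0 → q • y ≠ 0 → σ y * σ y = 1 := fun y hy hne => by
    refine hg2 _ fun heq => hne ?_
    obtain ⟨k, rfl⟩ := hm
    have h2 : 2 • (q • y) = 0 := by
      rw [two_nsmul]; nth_rewrite 2 [heq]; exact add_neg_cancel _
    rwa [mul_comm, mul_nsmul', add_nsmul, one_nsmul, mul_comm 2, mul_nsmul', h2, nsmul_zero,
      zero_add] at hy
  have hW : ∀ ψ ∈ cosetSpace N d q m, (fun y => σ y * ψ y) ∈ cosetSpace N d q m := fun ψ hψ =>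
    ⟨fun y hy => hψ.1 y (right_ne_zero_of_mul hy), fun y z hz => by
      simp only [hσ2 y z hz, hψ.2 y z hz]⟩
  -- The indicator of the zero coset spans the kernel of multiplication by `σ` on the even part.
  let δ : StateSpace N d := fun y => if q • y = 0 then 1 else 0
  have hδ : δ ∈ paritySpace N d q m 1 := by
    refine mem_paritySpace.2 ⟨⟨fun y hy => ?_, fun y z hz => ?_⟩, fun y => ?_⟩
    · have : q • y = 0 := by
        by_contra h0
        exact hy (if_neg h0)
      rw [mul_comm, mul_nsmul', this, nsmul_zero]
    · simp only [δ, smul_add, hz, add_zero]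
    · simp only [δ, smul_neg, neg_eq_zero, one_mul]
  have hinv : ∀ ψ ∈ cosetSpace N d q m, ∀ y, q • y = 0 → ψ y = ψ 0 := fun ψ hψ y hy => by
    rw [← hψ.2 0 y hy, zero_add]
  let e : paritySpace N d q m 1 ≃ₗ[ℂ] paritySpace N d q m (-1) × ℂ :=
    { toFun := fun ψ => (⟨fun y => σ y * ψ.1 y, mem_paritySpace.2
        ⟨hW _ (mem_paritySpace.1 ψ.2).1, fun y => by
          rw [hσ1, (mem_paritySpace.1 ψ.2).2]; ring⟩⟩, ψ.1 0)
      map_add' := fun ψ φ => Prod.ext (Subtype.ext (funext fun y => mul_add _ _ _)) rfl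
      map_smul' := fun c ψ => Prod.ext (Subtype.ext (funext fun y => mul_left_comm _ _ _)) rfl
      invFun := fun p => (⟨fun y => σ y * p.1.1 y, mem_paritySpace.2
        ⟨hW _ (mem_paritySpace.1 p.1.2).1, fun y => by
          rw [hσ1, (mem_paritySpace.1 p.1.2).2]; ring⟩⟩ : paritySpace N d q m 1) + p.2 • ⟨δ, hδ⟩
      left_inv := fun ψ => by
        refine Subtype.ext (funext fun y => ?_)
        change σ y * (σ y * ψ.1 y) + ψ.1 0 * δ y = ψ.1 y
        have hψ := (mem_paritySpace.1 ψ.2).1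
        by_cases hy : q • y = 0
        · simp only [δ, if_pos hy, hσ0 y hy, hinv _ hψ y hy, zero_mul, zero_add, mul_one]
        · simp only [δ, if_neg hy, mul_zero, add_zero]
          by_cases h0 : ψ.1 y = 0
          · simp only [h0, mul_zero]
          · rw [← mul_assoc, hσ3 y (hψ.1 y h0) hy, one_mul]
      right_inv := fun p => by
        have hp := mem_paritySpace.1 p.1.2
        have h0 : p.1.1 0 = 0 := by
          have := hp.2 0
          rwa [neg_zero, neg_one_mul, self_eq_neg] at this
        refine Prod.ext (Subtype.ext (funext fun y => ?_)) ?_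
        · change σ y * (σ y * p.1.1 y + p.2 * δ y) = p.1.1 y
          by_cases hy : q • y = 0
          · rw [hσ0 y hy, zero_mul, hinv _ hp.1 y hy, h0]
          · simp only [δ, if_neg hy, mul_zero, add_zero]
            by_cases h0 : p.1.1 y = 0
            · simp only [h0, mul_zero]
            · rw [← mul_assoc, hσ3 y (hp.1.1 y h0) hy, one_mul]
        · change σ 0 * p.1.1 0 + p.2 * δ 0 = p.2
          simp only [h0, δ, nsmul_zero, if_true, mul_zero, zero_add, mul_one] }
  rw [e.finrank_eq, Module.finrank_prod, Module.finrank_self]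

theorem parityOp_mul_weylOp_neg (n : Fin d ⊕ Fin d → ZMod M) :
    parityOp N d * weylOp κ h (-n) = weylOp κ h n * parityOp N d := by
  refine LinearMap.ext fun ψ => funext fun y => ?_
  change weylOp κ h (-n) ψ (-y) = weylOp κ h n (parityOp N d ψ) y
  have e1 : ∀ f : Fin d → Fin d ⊕ Fin d, (-n) ∘ f = -(n ∘ f) := fun _ => rfl
  have e2 : ∀ v : Fin d → ZMod M,
      ZMod.castHom h (ZMod N) ∘ (-v) = -(ZMod.castHom h (ZMod N) ∘ v) := fun v => by
    ext; simp only [Function.comp_apply, Pi.neg_apply, map_neg]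
  rw [weylOp_apply, weylOp_apply, e1, e1, e2, e2, neg_dotProduct_neg, neg_dotProduct_neg]
  congr 1
  change _ = ψ (-(y + _))
  rw [neg_add]

theorem parityOp_parityOp (ψ : StateSpace N d) : parityOp N d (parityOp N d ψ) = ψ :=
  funext fun y => congrArg ψ (neg_neg y)

/-- An injective intertwiner preserving the coset space preserves its even and odd parts. -/
theorem Intertwines.mem_paritySpace {A : Matrix (Fin d ⊕ Fin d) (Fin d ⊕ Fin d) (ZMod M)}
    {U : Module.End ℂ (StateSpace N d)} (hA : Intertwines κ h A U) (hU : Function.Bijective U)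
    {q m : ℕ} (hm : Odd m) (hW : ∀ ψ ∈ cosetSpace N d q m, U ψ ∈ cosetSpace N d q m)
    {ε : ℂ} {ψ : StateSpace N d} (hψ : ψ ∈ paritySpace N d q m ε) :
    U ψ ∈ paritySpace N d q m ε := by
  -- Both products of `U` with parity intertwine for `-A`, so they differ by a scalar `c`, and `c *
  -- c = 1` because parity is an involution.
  have h1 : Intertwines κ h (-A) (U * parityOp N d) := fun n => by
    rw [vecMul_neg, mul_assoc, parityOp_mul_weylOp_neg, ← mul_assoc, hA, mul_assoc]
  have h2 : Intertwines κ h (-A) (parityOp N d * U) := fun n => by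
    have : n ᵥ* (-A) = (-n) ᵥ* A := by rw [vecMul_neg, neg_vecMul]
    rw [this, mul_assoc, hA, ← mul_assoc, parityOp_mul_weylOp_neg, mul_assoc]
  have hP : Function.Bijective (parityOp N d) :=
    Function.Involutive.bijective parityOp_parityOp
  obtain ⟨c, hc⟩ := h2.exists_eq_smul h1 (hU.comp hP)
  have hc' : ∀ φ, parityOp N d (U φ) = c • U (parityOp N d φ) := LinearMap.congr_fun hc
  have hmap : ∀ ε : ℂ, ∀ φ ∈ paritySpace N d q m ε, U φ ∈ paritySpace N d q m (c * ε) := by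
    intro ε φ hφ
    refine Submodule.mem_inf.2 ⟨hW φ (Submodule.mem_inf.1 hφ).1, ?_⟩
    rw [Module.End.mem_eigenspace_iff, hc',
      Module.End.mem_eigenspace_iff.1 (Submodule.mem_inf.1 hφ).2, map_smul, smul_smul]
  have hcc : c * c = 1 := by
    have hne : (Pi.single 0 1 : StateSpace N d) ≠ 0 := by simp
    have h3 := hc' (parityOp N d (Pi.single 0 1))
    rw [parityOp_parityOp] at h3
    have h4 := congrArg (parityOp N d) h3
    rw [parityOp_parityOp, map_smul, hc', smul_smul] at h4
    by_contra hcc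
    refine hne (hP.1 (hU.1 ?_))
    rw [map_zero, map_zero]
    have h5 : (1 - c * c) • U (parityOp N d (Pi.single 0 1)) = 0 := by
      rw [sub_smul, one_smul, ← h4, sub_self]
    exact (smul_eq_zero.1 h5).resolve_left (sub_ne_zero.2 (Ne.symm hcc))
  rcases mul_self_eq_one_iff.1 hcc with rfl | rfl
  · simpa using hmap ε ψ hψ
  -- If `c = -1`, `U` would inject the even part into the odd part, which has smaller dimension.
  · exfalso
    have h6 := LinearMap.finrank_le_finrank_of_injective
      (f := U.restrict (p := paritySpace N d q m 1) (q := paritySpace N d q m (-1))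
        fun φ hφ => by simpa using hmap 1 φ hφ)
      fun v w hvw => Subtype.ext (hU.1 (congrArg Subtype.val hvw))
    rw [finrank_paritySpace_one hm] at h6
    omega

theorem comp_castHom_nsmul (k : ℕ) (a : Fin d → ZMod M) :
    ZMod.castHom h (ZMod N) ∘ (k • a) = k • (ZMod.castHom h (ZMod N) ∘ a) := by
  ext; simp only [Function.comp_apply, Pi.smul_apply, map_nsmul]

/-- On the support $qmy=0$, so the modulation is trivial. The translation vector is killed by $q$
because $qrm=N$. The phase must be assumed trivial, since $\kappa$ need not factor through $\mathbb
Z/N$. -/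
theorem weylOp_apply_of_mem_cosetSpace {q r m : ℕ} (hN : N = q * r * m) {ψ : StateSpace N d}
    (hψ : ψ ∈ cosetSpace N d q m) (a b : Fin d → ZMod M)
    (h1 : κ (((r * m) • a) ⬝ᵥ ((q * m) • b)) = 1) :
    weylOp κ h (Sum.elim ((r * m) • a) ((q * m) • b)) ψ = ψ := by
  ext y
  rw [weylOp_apply, Sum.elim_comp_inl, Sum.elim_comp_inr, h1, one_mul, hψ.2]
  · by_cases h0 : ψ y = 0
    · rw [h0, mul_zero]
    · rw [comp_castHom_nsmul, smul_dotProduct, ← dotProduct_smul, hψ.1 y h0]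
      simp
  · rw [comp_castHom_nsmul, smul_smul, ← mul_assoc, ← hN]
    ext i
    simp

/-- Invariance under the modulations forces the support condition by separation of characters.
Invariance under the translations suffices because $qz=0$ makes $z$ a multiple of $rm=N/q$. -/
theorem mem_cosetSpace_of_weylOp_apply {q r m : ℕ} (hN : N = q * r * m) {ψ : StateSpace N d}
    (h1 : ∀ a, weylOp κ h (Sum.elim ((r * m) • a) 0) ψ = ψ)
    (h2 : ∀ b, weylOp κ h (Sum.elim 0 ((q * m) • b)) ψ = ψ) : ψ ∈ cosetSpace N d q m := by
  refine ⟨fun y hy => eq_zero_of_stdAddChar_dotProduct fun b => ?_, fun y z hz => ?_⟩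
  · obtain ⟨b, rfl⟩ := exists_comp_castHom_eq h b
    have h3 := congrFun (h2 b) y
    rw [weylOp_elim_zero_apply, comp_castHom_nsmul, smul_dotProduct, ← dotProduct_smul] at h3
    exact mul_right_cancel₀ hy (by rw [h3, one_mul])
  · have hdvd : ∀ i, ∃ t : ZMod N, z i = (r * m) • t := fun i => by
      obtain ⟨j, hj⟩ := ZMod.natCast_zmod_surjective (z i)
      have h4 : ((q * j : ℕ) : ZMod N) = 0 := by
        have := congrFun hz i
        rw [Pi.smul_apply, Pi.zero_apply, ← hj, nsmul_eq_mul] at this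
        rw [Nat.cast_mul, this]
      rw [ZMod.natCast_eq_zero_iff, hN, mul_assoc] at h4
      have hq : 0 < q := by
        rcases Nat.eq_zero_or_pos q with rfl | hq
        · exact absurd (by rw [hN, zero_mul, zero_mul]) (NeZero.ne N)
        · exact hq
      obtain ⟨t, ht⟩ := Nat.dvd_of_mul_dvd_mul_left hq h4
      exact ⟨t, by rw [← hj, ht, nsmul_eq_mul, ← Nat.cast_mul]⟩
    choose t ht using hdvd
    obtain ⟨a, rfl⟩ := exists_comp_castHom_eq h t
    have h3 := congrFun (h1 a) y
    rw [weylOp_elim_apply_zero, comp_castHom_nsmul] at h3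
    rwa [show z = (r * m) • (ZMod.castHom h (ZMod N) ∘ a) from funext ht]

/-! ### From the coset space to the representation. -/

theorem isPropagator_iff
    (hT : ∀ n : Fin d ⊕ Fin d → ℤ, twistedOp N n = weylOp κ h fun i => (n i : ZMod M))
    {A : Matrix (Fin d ⊕ Fin d) (Fin d ⊕ Fin d) (ZMod M)} {U : Module.End ℂ (StateSpace N d)} :
    IsPropagator N A U ↔ IsUnitaryOperator U ∧ Intertwines κ h A U := by
  refine and_congr_right fun _ => ⟨fun hU n => ?_, fun hU n m hnm => ?_⟩
  · choose n' hn' using fun i => ZMod.intCast_surjective (n i)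
    choose m' hm' using fun i => ZMod.intCast_surjective ((n ᵥ* A) i)
    have h1 := hU n' m' (by rw [funext hn', funext hm'])
    rwa [hT, hT, funext hn', funext hm'] at h1
  · rw [hT, hT, hnm, hU]

/-- The propagators of a finite group of symplectic matrices preserving the coset space can be
normalized to a representation. -/
theorem exists_representation_of_cosetSpace {G : Type*} [Group G] [Finite G]
    (ι : G →* symplecticGroup (Fin d) (ZMod M)) (hκ : IsHalfChar κ h)
    (hT : ∀ n : Fin d ⊕ Fin d → ℤ, twistedOp N n = weylOp κ h fun i => (n i : ZMod M))
    {q r m : ℕ} (hN : N = q * r * m) (hm : Odd m)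
    (h1 : ∀ g, ∀ ψ ∈ cosetSpace N d q m, ∀ a : Fin d → ZMod M,
      weylOp κ h (Sum.elim ((r * m) • a) 0 ᵥ* (ι g).1) ψ = ψ)
    (h2 : ∀ g, ∀ ψ ∈ cosetSpace N d q m, ∀ b : Fin d → ZMod M,
      weylOp κ h (Sum.elim 0 ((q * m) • b) ᵥ* (ι g).1) ψ = ψ) :
    (∃ ρ : Representation ℂ G (StateSpace N d), ∀ g,
      IsPropagator N (ι g : Matrix (Fin d ⊕ Fin d) (Fin d ⊕ Fin d) (ZMod M)) (ρ g)) ∧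
    ∀ U : G → Module.End ℂ (StateSpace N d),
      (∀ g, IsPropagator N (ι g : Matrix (Fin d ⊕ Fin d) (Fin d ⊕ Fin d) (ZMod M)) (U g)) →
      ∃ c : G → Circle, ∃ ρ : Representation ℂ G (StateSpace N d), ∀ g, ρ g = (c g : ℂ) • U g := by
  have hex : ∃ ρ : Representation ℂ G (StateSpace N d), ∀ g,
      IsPropagator N (ι g : Matrix (Fin d ⊕ Fin d) (Fin d ⊕ Fin d) (ZMod M)) (ρ g) := by
    choose U hU hA using fun g => exists_unitary_intertwiner (N := N) hκ (ι g)
    -- `U g` carries the fixed vectors of $T(nA)$ to those of $T(n)$, and the coset space is cut out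
    -- by such fixed-vector conditions.
    have hW : ∀ g, ∀ ψ ∈ cosetSpace N d q m, U g ψ ∈ cosetSpace N d q m := fun g ψ hψ => by
      have key : ∀ n, weylOp κ h (n ᵥ* (ι g).1) ψ = ψ →
          weylOp κ h n (U g ψ) = U g ψ := fun n hn => by
        have := LinearMap.congr_fun (hA g n) ψ
        rw [Module.End.mul_apply, Module.End.mul_apply, hn] at this
        exact this.symm
      exact mem_cosetSpace_of_weylOp_apply hN (fun a => key _ (h1 g ψ hψ a))
        fun b => key _ (h2 g ψ hψ b)
    obtain ⟨c, ρ, hρ⟩ := exists_monoidHom_of_projective U (fun g => (hU g).1.1)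
      (fun g k => by
        have h3 := (hA g).mul (hA k)
        rw [← Submonoid.coe_mul, ← map_mul] at h3
        exact h3.exists_eq_smul (hA (g * k)) (hU (g * k)).1)
      (paritySpace N d q m 1) (paritySpace N d q m (-1))
      (fun g v hv => (hA g).mem_paritySpace (hU g).1 hm (hW g) hv)
      (fun g v hv => (hA g).mem_paritySpace (hU g).1 hm (hW g) hv)
      (finrank_paritySpace_one hm)
    refine ⟨ρ, fun g => (isPropagator_iff hT).2 ⟨?_, ?_⟩⟩
    · rw [hρ]
      -- The group is finite, so `ρ g` has finite order, which forces the scalar to have modulus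
      -- one.
      refine (hU g).smul (norm_eq_one_of_smul_pow_eq_one (hU g) (Nat.card_pos (α := G)).ne' ?_)
      rw [← hρ, ← map_pow, pow_card_eq_one', map_one]
    · rw [hρ]
      exact (hA g).smul _
  refine ⟨hex, fun U hU => ?_⟩
  obtain ⟨ρ, hρ⟩ := hex
  have hc : ∀ g, ∃ c : Circle, ρ g = (c : ℂ) • U g := fun g => by
    have h3 := (isPropagator_iff hT).1 (hU g)
    have h4 := (isPropagator_iff hT).1 (hρ g)
    obtain ⟨c, hc⟩ := h4.2.exists_eq_smul h3.2 h3.1.1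
    have h5 := h4.1
    rw [hc] at h5
    exact ⟨⟨c, mem_sphere_zero_iff_norm.2 (norm_eq_one_of_isUnitaryOperator_smul h3.1 h5)⟩, hc⟩
  choose c hc using hc
  exact ⟨c, ρ, hc⟩

/-! ### The half characters for odd and even $N$. -/

theorem twistedOp_eq_weylOp
    (hκ : ∀ s : ℤ, κ s = (-1 : ℂ) ^ ((N : ℤ) * s) * ZMod.stdAddChar (s : ZMod (2 * N)))
    (n : Fin d ⊕ Fin d → ℤ) : twistedOp N n = weylOp κ h fun i => (n i : ZMod M) := by
  refine LinearMap.ext fun ψ => funext fun y => ?_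
  have e1 : ((fun i => (n i : ZMod M)) ∘ Sum.inl) ⬝ᵥ ((fun i => (n i : ZMod M)) ∘ Sum.inr) =
      (((n ∘ Sum.inl) ⬝ᵥ (n ∘ Sum.inr) : ℤ) : ZMod M) := by
    simp [dotProduct]
  have e2 : ∀ f : Fin d → Fin d ⊕ Fin d, ZMod.castHom h (ZMod N) ∘ (fun i => (n i : ZMod M)) ∘ f =
      fun i => (n (f i) : ZMod N) := fun f => by
    ext i; simp only [Function.comp_apply, map_intCast]
  rw [weylOp_apply, e1, e2, e2, hκ, mul_assoc, mul_assoc, twistedOp, LinearMap.smul_apply,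
    Pi.smul_apply, smul_eq_mul, elemOp]
  simp only [LinearMap.coe_mk, AddHom.coe_mk, mul_assoc]

/-- $(N+1)/2$ is the inverse of $2$ modulo $N$. -/
theorem isHalfChar_of_odd (hN : Odd N) :
    IsHalfChar ((ZMod.stdAddChar (N := N)).mulShift ((N + 1) / 2 : ℕ)) (dvd_refl N) := by
  obtain ⟨k, hk⟩ := hN
  refine ⟨fun x => ?_, fun x y hx _ => ?_⟩
  · rw [AddChar.mulShift_apply, ← mul_assoc]
    have h1 : (((N + 1) / 2 : ℕ) : ZMod N) * 2 = 1 := by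
      have h2 : (N + 1) / 2 * 2 = N + 1 := by omega
      have h3 := congrArg (Nat.cast : ℕ → ZMod N) h2
      simpa using h3
    rw [h1, one_mul]
    simp
  · have : x = 0 := by simpa using hx
    rw [this, zero_mul, AddChar.map_zero_eq_one]

theorem mulShift_stdAddChar_intCast_of_odd (hN : Odd N) (s : ℤ) :
    (ZMod.stdAddChar (N := N)).mulShift ((N + 1) / 2 : ℕ) (s : ZMod N) =
      (-1 : ℂ) ^ ((N : ℤ) * s) * ZMod.stdAddChar (s : ZMod (2 * N)) := by
  obtain ⟨k, hk⟩ := hN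
  have h2 : (N + 1) / 2 = k + 1 := by omega
  have hN0 : (N : ℂ) ≠ 0 := Nat.cast_ne_zero.2 (NeZero.ne N)
  have hNk : (N : ℂ) = 2 * k + 1 := by rw [hk]; push_cast; ring
  have e : (((k + 1 : ℕ) : ZMod N)) * (s : ZMod N) = (((k + 1) * s : ℤ) : ZMod N) := by
    push_cast; ring
  rw [AddChar.mulShift_apply, h2, e, ZMod.stdAddChar_coe, ZMod.stdAddChar_coe, ← Complex.exp_pi_mul_I,
    ← Complex.exp_int_mul, ← Complex.exp_add, Complex.exp_eq_exp_iff_exists_int]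
  -- With $N=2k+1$, the exponents differ by $2\pi i$ times
  -- $\frac{(k+1)s}{N}-\frac{s}{2N}-\frac{Ns}{2}=-ks$.
  refine ⟨-(k * s), ?_⟩
  push_cast
  field_simp
  rw [hNk]
  ring

theorem isHalfChar_of_even (hN : Even N) :
    IsHalfChar (ZMod.stdAddChar (N := 2 * N)) (dvd_mul_left N 2) := by
  have hN0 : (N : ℂ) ≠ 0 := Nat.cast_ne_zero.2 (NeZero.ne N)
  refine ⟨fun x => ?_, fun x y hx hy => ?_⟩
  · obtain ⟨j, rfl⟩ := ZMod.intCast_surjective x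
    have e : 2 * (j : ZMod (2 * N)) = ((2 * j : ℤ) : ZMod (2 * N)) := by push_cast; rfl
    rw [map_intCast, e, ZMod.stdAddChar_coe, ZMod.stdAddChar_coe]
    congr 1
    push_cast
    field_simp
  · obtain ⟨i, rfl⟩ := ZMod.intCast_surjective x
    obtain ⟨j, rfl⟩ := ZMod.intCast_surjective y
    rw [map_intCast, ZMod.intCast_zmod_eq_zero_iff_dvd] at hx hy
    obtain ⟨k, hk⟩ := hN
    -- $2N$ divides $N^2$ because $N$ is even.
    have h1 : ((2 * N : ℕ) : ℤ) ∣ i * j := by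
      refine dvd_trans ?_ (mul_dvd_mul hx hy)
      exact ⟨k, by rw [hk]; push_cast; ring⟩
    rw [← Int.cast_mul, (ZMod.intCast_zmod_eq_zero_iff_dvd _ _).2 h1, AddChar.map_zero_eq_one]

theorem stdAddChar_intCast_of_even (hN : Even N) (s : ℤ) :
    ZMod.stdAddChar (s : ZMod (2 * N)) =
      (-1 : ℂ) ^ ((N : ℤ) * s) * ZMod.stdAddChar (s : ZMod (2 * N)) := by
  rw [Even.neg_one_zpow ((Int.even_coe_nat N).2 hN |>.mul_right s), one_mul]

/-! ### Matrices congruent to $\pm1$ modulo $4$. -/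

/-- An even number is `q · (qc) · m` with `m` odd and `c ∈ {1, 2}`. -/
theorem exists_eq_mul_of_ne_zero {n : ℕ} (hn : n ≠ 0) :
    ∃ q c e m : ℕ, c * e = 2 ∧ Odd m ∧ n = q * (q * c) * m := by
  obtain ⟨k, m, hm, rfl⟩ := Nat.exists_eq_two_pow_mul_odd hn
  rcases Nat.even_or_odd' k with ⟨j, rfl | rfl⟩
  · exact ⟨2 ^ j, 1, 2, m, rfl, hm, by ring⟩
  · exact ⟨2 ^ j, 2, 1, m, rfl, hm, by ring⟩

/-- A matrix congruent to `E = ±1` modulo `4` is `E + 4B`. -/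
theorem exists_eq_add_four_smul {M : ℕ} {n : Type*} (h : 4 ∣ M) {A E : Matrix n n (ZMod M)}
    (hA : A.map (ZMod.castHom h (ZMod 4)) = E.map (ZMod.castHom h (ZMod 4))) :
    ∃ B : Matrix n n (ZMod M), A = E + (4 : ℕ) • B := by
  have h1 : ∀ i j, ∃ b, A i j - E i j = (4 : ℕ) • b := fun i j => by
    obtain ⟨t, ht⟩ := ZMod.intCast_surjective (A i j - E i j)
    have h2 : ZMod.castHom h (ZMod 4) (A i j - E i j) = 0 := by
      rw [map_sub, sub_eq_zero]
      exact congrFun (congrFun hA i) j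
    rw [← ht, map_intCast, ZMod.intCast_zmod_eq_zero_iff_dvd] at h2
    obtain ⟨s, rfl⟩ := h2
    exact ⟨s, by rw [← ht]; push_cast; rw [nsmul_eq_mul]; push_cast; rfl⟩
  choose B hB using h1
  refine ⟨Matrix.of B, ?_⟩
  ext i j
  rw [Matrix.add_apply, Matrix.smul_apply, Matrix.of_apply, ← hB]
  ring

theorem pmOneSubgroup_exists_eq {M : ℕ} (h : 4 ∣ M) (A : pmOneSubgroup d h) :
    ∃ (ε : ℤ) (B : Matrix (Fin d ⊕ Fin d) (Fin d ⊕ Fin d) (ZMod M)),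
      (A.1 : Matrix (Fin d ⊕ Fin d) (Fin d ⊕ Fin d) (ZMod M)) = ε • 1 + (4 : ℕ) • B := by
  have e1 : (1 : Matrix (Fin d ⊕ Fin d) (Fin d ⊕ Fin d) (ZMod M)).map
      (ZMod.castHom h (ZMod 4)) = 1 := Matrix.map_one _ (map_zero _) (map_one _)
  rcases A.2 with hA | hA
  · obtain ⟨B, hB⟩ := exists_eq_add_four_smul h (hA.trans e1.symm)
    exact ⟨1, B, by rw [hB, one_smul]⟩
  · have e2 : (-1 : Matrix (Fin d ⊕ Fin d) (Fin d ⊕ Fin d) (ZMod M)).map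
        (ZMod.castHom h (ZMod 4)) = -1 := by
      rw [Matrix.map_neg _ (map_neg _), e1]
    obtain ⟨B, hB⟩ := exists_eq_add_four_smul h (hA.trans e2.symm)
    exact ⟨-1, B, by rw [hB, neg_one_smul]⟩

/-- The lattice consists of the vectors $(qcm\,x,\;qm\,y)$. Adding $4B$ keeps its generators inside:
a factor $2=ce$ of the $4$ absorbs the possible index $c$ between the two coordinates. The other
factor $2$ raises the phase argument from a multiple of $N$ to a multiple of $2N$. -/
theorem weylOp_vecMul_apply_of_mem_cosetSpace {q c e m : ℕ} (hce : c * e = 2)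
    (hN : N = q * (q * c) * m) {ε : ℤ}
    {κ : AddChar (ZMod (2 * N)) ℂ} {h : N ∣ 2 * N}
    (B : Matrix (Fin d ⊕ Fin d) (Fin d ⊕ Fin d) (ZMod (2 * N)))
    {ψ : StateSpace N d} (hψ : ψ ∈ cosetSpace N d q m) (a : Fin d → ZMod (2 * N)) :
    weylOp κ h (Sum.elim ((q * c * m) • a) 0 ᵥ* (ε • 1 + (4 : ℕ) • B)) ψ = ψ ∧
      weylOp κ h (Sum.elim 0 ((q * m) • a) ᵥ* (ε • 1 + (4 : ℕ) • B)) ψ = ψ := by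
  have h0 : ∀ (k : ℕ) (x y : Fin d → ZMod (2 * N)),
      κ (((q * c * m) • x) ⬝ᵥ ((q * m) • ((2 * k) • y))) = 1 := fun k x y => by
    have e1 : ((q * c * m) • x) ⬝ᵥ ((q * m) • ((2 * k) • y)) =
        ((2 * N : ℕ) : ZMod (2 * N)) * ((m * k : ℕ) * (x ⬝ᵥ y)) := by
      have e2 : ((2 * N : ℕ) : ZMod (2 * N)) = (2 * (q * (q * c) * m) : ℕ) :=
        congrArg (fun t : ℕ => ((2 * t : ℕ) : ZMod (2 * N))) hN
      rw [e2, smul_dotProduct, dotProduct_smul, dotProduct_smul]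
      simp only [nsmul_eq_mul]
      push_cast
      ring
    rw [e1, ZMod.natCast_self, zero_mul, AddChar.map_zero_eq_one]
  have h0' : ∀ (k : ℕ) (x y : Fin d → ZMod (2 * N)),
      κ (((q * c * m) • ((2 * k) • x)) ⬝ᵥ ((q * m) • y)) = 1 := fun k x y => by
    rw [← h0 k x y]
    simp only [smul_dotProduct, dotProduct_smul]
    congr 1
    simp only [nsmul_eq_mul]
    ring
  have hv : ∀ v : Fin d ⊕ Fin d → ZMod (2 * N), v ᵥ* (ε • 1 + (4 : ℕ) • B) =
      ε • v + (4 : ℕ) • (v ᵥ* B) := fun v => by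
    rw [vecMul_add, vecMul_smul, vecMul_smul, vecMul_one]
  constructor
  · set w := Sum.elim a 0 ᵥ* B with hw
    have e1 : Sum.elim ((q * c * m) • a) 0 ᵥ* (ε • 1 + (4 : ℕ) • B) =
        Sum.elim ((q * c * m) • (ε • a + (4 : ℕ) • (w ∘ Sum.inl)))
          ((q * m) • ((2 * (2 * c)) • (w ∘ Sum.inr))) := by
      have e2 : Sum.elim ((q * c * m) • a) (0 : Fin d → ZMod (2 * N)) =
          (q * c * m) • Sum.elim a (0 : Fin d → ZMod (2 * N)) := by
        ext i; rcases i with i | i <;> simp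
      rw [e2, smul_vecMul, hv, ← hw]
      ext i
      rcases i with i | i
      · simp
      · simp
        ring
    rw [e1]
    exact weylOp_apply_of_mem_cosetSpace hN hψ _ _ (h0 _ _ _)
  · set w := Sum.elim (0 : Fin d → ZMod (2 * N)) a ᵥ* B with hw
    have e1 : Sum.elim 0 ((q * m) • a) ᵥ* (ε • 1 + (4 : ℕ) • B) =
        Sum.elim ((q * c * m) • ((2 * e) • (w ∘ Sum.inl)))
          ((q * m) • (ε • a + (4 : ℕ) • (w ∘ Sum.inr))) := by
      have e2 : Sum.elim (0 : Fin d → ZMod (2 * N)) ((q * m) • a) =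
          (q * m) • Sum.elim (0 : Fin d → ZMod (2 * N)) a := by
        ext i; rcases i with i | i <;> simp
      have hce' : (c : ZMod (2 * N)) * e = 2 := by exact_mod_cast congrArg (Nat.cast : ℕ → ZMod (2 * N)) hce
      rw [e2, smul_vecMul, hv, ← hw]
      ext i
      rcases i with i | i
      · simp
        -- Here $4\,qm=qcm\cdot 2e$, because $ce=2$.
        linear_combination (-2 * (q : ZMod (2 * N)) * m * w (Sum.inl i)) * hce'
      · simp
    rw [e1]
    exact weylOp_apply_of_mem_cosetSpace hN hψ _ _ (h0' _ _ _)

end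

/-! ### The theorem. -/

theorem mainTheorem5 (d N : ℕ) [NeZero N] (hN : 1 < N) :
    (Odd N →
      (∃ ρ : Representation ℂ (symplecticGroup (Fin d) (ZMod N)) (StateSpace N d),
        ∀ A : symplecticGroup (Fin d) (ZMod N),
          IsPropagator N (A : Matrix (Fin d ⊕ Fin d) (Fin d ⊕ Fin d) (ZMod N)) (ρ A)) ∧
      (∀ U : symplecticGroup (Fin d) (ZMod N) → Module.End ℂ (StateSpace N d),
        (∀ A : symplecticGroup (Fin d) (ZMod N),
          IsPropagator N (A : Matrix (Fin d ⊕ Fin d) (Fin d ⊕ Fin d) (ZMod N)) (U A)) →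
        ∃ c : symplecticGroup (Fin d) (ZMod N) → Circle,
          ∃ ρ : Representation ℂ (symplecticGroup (Fin d) (ZMod N)) (StateSpace N d),
            ∀ A, ρ A = (c A : ℂ) • U A)) ∧
    (∀ h : Even N,
      (∃ ρ : Representation ℂ (pmOneSubgroup d (four_dvd_two_mul_of_even h)) (StateSpace N d),
        ∀ A : pmOneSubgroup d (four_dvd_two_mul_of_even h),
          IsPropagator N (A.1 : Matrix (Fin d ⊕ Fin d) (Fin d ⊕ Fin d) (ZMod (2 * N))) (ρ A)) ∧
      (∀ U : pmOneSubgroup d (four_dvd_two_mul_of_even h) → Module.End ℂ (StateSpace N d),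
        (∀ A : pmOneSubgroup d (four_dvd_two_mul_of_even h),
          IsPropagator N (A.1 : Matrix (Fin d ⊕ Fin d) (Fin d ⊕ Fin d) (ZMod (2 * N))) (U A)) →
        ∃ c : pmOneSubgroup d (four_dvd_two_mul_of_even h) → Circle,
          ∃ ρ : Representation ℂ (pmOneSubgroup d (four_dvd_two_mul_of_even h)) (StateSpace N d),
            ∀ A, ρ A = (c A : ℂ) • U A)) := by
  have hfin : ∀ (M : ℕ) [NeZero M], Finite (symplecticGroup (Fin d) (ZMod M)) := fun M _ =>
    have : Finite (Matrix (Fin d ⊕ Fin d) (Fin d ⊕ Fin d) (ZMod M)) :=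
      inferInstanceAs (Finite (Fin d ⊕ Fin d → Fin d ⊕ Fin d → ZMod M))
    Finite.of_injective Subtype.val Subtype.val_injective
  constructor
  · intro hodd
    have := hfin N
    -- For odd $N$, with $q=r=1$ and $m=N$, the coset space is everything and the lattice is zero,
    -- so invariance is automatic.
    have h0 : ∀ a : Fin d → ZMod N, (1 * N) • a = 0 := fun a => by ext; simp
    refine exists_representation_of_cosetSpace
      (MonoidHom.id (symplecticGroup (Fin d) (ZMod N))) (isHalfChar_of_odd hodd)
      (twistedOp_eq_weylOp (mulShift_stdAddChar_intCast_of_odd hodd))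
      (q := 1) (r := 1) (m := N) (by ring) hodd (fun g ψ _ a => ?_) fun g ψ _ a => ?_
    all_goals rw [h0, Sum.elim_zero_zero, zero_vecMul, weylOp_zero, Module.End.one_apply]
  · intro h
    have := hfin (2 * N)
    obtain ⟨q, c, e, m, hce, hm, hq⟩ := exists_eq_mul_of_ne_zero (NeZero.ne N)
    refine exists_representation_of_cosetSpace
      (pmOneSubgroup d (four_dvd_two_mul_of_even h)).subtype (isHalfChar_of_even h)
      (twistedOp_eq_weylOp (stdAddChar_intCast_of_even h)) hq hm
      (fun A ψ hψ a => ?_) fun A ψ hψ a => ?_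
    all_goals
      obtain ⟨ε, B, hB⟩ := pmOneSubgroup_exists_eq _ A
      rw [Subgroup.subtype_apply, hB]
    · exact (weylOp_vecMul_apply_of_mem_cosetSpace hce hq B hψ a).1
    · exact (weylOp_vecMul_apply_of_mem_cosetSpace hce hq B hψ a).2
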